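/- Let $X$ be a reflexive real Banach space with dual $X^*$, let $C\subseteq X$ be nonempty, and let $F,G:C\times C\to\mathbb{R}$ satisfy $F(x,x)=G(x,x)=0$ for all $x\in C$. A function $H:C\times C\to\mathbb{R}$ is called monotone if $H(x,y)+H(y,x)\le 0$ for all $x,y\in C$. With $H$ one associates the operator $A^H:X\rightrightarrows X^*$, where $A^H(x)=\{x^*\in X^*: H(x,y)-H(x,x)\ge\langle x^*,y-x\rangle\ \forall y\in C\}$ if $x\in C$ and $A^H(x)=\emptyset$ otherwise; $H$ is called maximal monotone if it is monotone and $A^H$ is a maximal monotone operator. Write $D(T)=\{x: T(x)\ne\emptyset\}$ for the domain of an operator $T:X\rightrightarrows X^*$. A representative function of a monotone operator $T:X\rightrightarrows X^*$ is a convex, norm lower semicontinuous function $h:X\times X^*\to\overline{\mathbb{R}}$ with $h(x,x^*)\ge\langle x^*,x\rangle$ for all $(x,x^*)\in X\times X^*$ and $h(x,x^*)=\langle x^*,x\rangle$ whenever $x^*\in T(x)$. For $U\subseteq X$ let $\mathrm{sqri}(U)$ be the set of all $x\in U$ such that $\mathrm{cone}(U-x)=\{t(u-x): t\ge 0,\ u\in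 U\}$ is a closed linear subspace of $X$. For $f,g:X\times X^*\to(-\infty,+\infty]$ put $(f\square_2 g)(x,x^*)=\inf\{f(x,u^*)+g(x,x^*-u^*): u^*\in X^*\}$. Let $\mathrm{dom} f=\{f<+\infty\}$ and let $\mathrm{pr}_X:X\times X^*\to X$ be the projection. Suppose that $F$ and $G$ are maximal monotone, and let $f_F$ and $f_G$ be representative functions of $A^F$ and $A^G$, respectively. Then $$0\in\mathrm{sqri}\big(D(A^F)-D(A^G)\big)\iff 0\in\mathrm{sqri}\big(\mathrm{pr}_X(\mathrm{dom} f_F)-\mathrm{pr}_X(\mathrm{dom} f_G)\big),$$ and if these equivalent conditions hold, then $F+G$ is maximal monotone, $A^F(x)+A^G(x)=A^{F+G}(x)$ for all $x\in X$, and $f_F\square_2 f_G$ is a representative function of $A^{F+G}$. -/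

import Mathlib

open scoped Pointwise

noncomputable section

/-- A normed space is reflexive if the canonical map into its bidual is onto. -/
def IsReflexiveSpace (X : Type*) [NormedAddCommGroup X] [NormedSpace ℝ X] : Prop :=
  Function.Surjective (NormedSpace.inclusionInDoubleDual ℝ X)

/-- The conical hull `{t u : t ≥ 0, u ∈ U}`. -/
def coneOf {X : Type*} [AddCommGroup X] [Module ℝ X] (U : Set X) : Set X :=
  {y | ∃ t : ℝ, 0 ≤ t ∧ ∃ u ∈ U, y = t • u}

/-- The strong quasi relative interior: points `x` of `U` for which the conical hull of `U - x`
is a closed linear subspace. -/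
def sqri {X : Type*} [NormedAddCommGroup X] [NormedSpace ℝ X] (U : Set X) : Set X :=
  {x | x ∈ U ∧ ∃ Y : Submodule ℝ X, IsClosed (Y : Set X) ∧
    coneOf ((fun u => u - x) '' U) = (Y : Set X)}

/-- The effective domain of an extended real valued function. -/
def effDom {E : Type*} (f : E → EReal) : Set E := {p | f p < ⊤}

/-- Convexity of an extended real valued function, as convexity of its epigraph. -/
def IsConvexFun {E : Type*} [AddCommGroup E] [Module ℝ E] (f : E → EReal) : Prop :=
  Convex ℝ {p : E × ℝ | f p.1 ≤ (p.2 : EReal)}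

/-- Partial infimal convolution `(f □₂ g)(a, b) = inf {f (a, c) + g (a, b - c) : c ∈ B}`. It is
used only for functions that never take the value `-∞`. -/
def infConvSnd {A B : Type*} [AddCommGroup B] (f g : A × B → EReal) : A × B → EReal :=
  fun p => ⨅ c : B, f (p.1, c) + g (p.1, p.2 - c)

section Operators

variable {X : Type*} [NormedAddCommGroup X] [NormedSpace ℝ X]

/-- Monotonicity of a multifunction from `X` to its dual. -/
def IsMonotoneOp (T : X → Set (StrongDual ℝ X)) : Prop :=
  ∀ x y : X, ∀ x' ∈ T x, ∀ y' ∈ T y, 0 ≤ (y' - x') (y - x)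

/-- Maximality: the graph is not properly contained in the graph of a monotone operator. -/
def IsMaximalMonotoneOp (T : X → Set (StrongDual ℝ X)) : Prop :=
  IsMonotoneOp T ∧
    ∀ S : X → Set (StrongDual ℝ X), IsMonotoneOp S → (∀ x, T x ⊆ S x) → S = T

/-- The domain `D(T)`. -/
def opDom (T : X → Set (StrongDual ℝ X)) : Set X := {x | (T x).Nonempty}

/-- `h` is a representative function of the monotone operator `T`: it is convex and lower
semicontinuous for the norm topology of `X × X*`, it majorizes the coupling function
`c (x, x*) = ⟨x*, x⟩` and it agrees with `c` on the graph of `T`. -/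
structure IsRepresentative (h : X × StrongDual ℝ X → EReal)
    (T : X → Set (StrongDual ℝ X)) : Prop where
  monotone : IsMonotoneOp T
  convex : IsConvexFun h
  lsc : LowerSemicontinuous h
  coupling_le : ∀ (x : X) (x' : StrongDual ℝ X), ((x' x : ℝ) : EReal) ≤ h (x, x')
  eq_coupling : ∀ (x : X), ∀ x' ∈ T x, h (x, x') = ((x' x : ℝ) : EReal)

/-- Monotonicity of a bifunction on `C`. -/
def IsMonotoneBif {C : Set X} (F : C → C → ℝ) : Prop :=
  ∀ x y : C, F x y + F y x ≤ 0

/-- The operator `A^F`: `x* ∈ A^F(x)` iff `x ∈ C` and `F(x, y) - F(x, x) ≥ ⟨x*, y - x⟩` for all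
`y ∈ C`. -/
def bifOp {C : Set X} (F : C → C → ℝ) : X → Set (StrongDual ℝ X) :=
  fun x => {x' | ∃ hx : x ∈ C, ∀ y : C, x' ((y : X) - x) ≤ F ⟨x, hx⟩ y - F ⟨x, hx⟩ ⟨x, hx⟩}

/-- A monotone bifunction `F` is maximal monotone if `A^F` is a maximal monotone operator. -/
def IsMaximalMonotoneBif {C : Set X} (F : C → C → ℝ) : Prop :=
  IsMonotoneBif F ∧ IsMaximalMonotoneOp (bifOp F)

end Operators

end

open scoped Pointwise
open Filter Topology

section Epigraphs

variable {X : Type*} [NormedAddCommGroup X] [NormedSpace ℝ X]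

/-- The projection to `X` of a set of epigraph type. -/
def epiDom (E : Set ((X × StrongDual ℝ X) × ℝ)) : Set X :=
  {x | ∃ u r, ((x, u), r) ∈ E}

/-- The epigraph of the (transposed) convex conjugate of the function with epigraph `E`. -/
def conjEpi (E : Set ((X × StrongDual ℝ X) × ℝ)) : Set ((X × StrongDual ℝ X) × ℝ) :=
  {p | ∀ q ∈ E, p.1.2 q.1.1 + q.1.2 p.1.1 - q.2 ≤ p.2}

/-- The graph of the coupling function restricted to the graph of `T`. -/
def couplingGraph (T : X → Set (StrongDual ℝ X)) : Set ((X × StrongDual ℝ X) × ℝ) :=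
  {p | p.1.2 ∈ T p.1.1 ∧ p.2 = p.1.2 p.1.1}

/-- The epigraph of the Fitzpatrick function of `T`. -/
def fitzEpi (T : X → Set (StrongDual ℝ X)) : Set ((X × StrongDual ℝ X) × ℝ) :=
  conjEpi (couplingGraph T)

/-- The epigraph of the function `(x, y, x') ↦ min_u f (x, u) + g (y, x' - u)`. -/
def epiInfConv (E E' : Set ((X × StrongDual ℝ X) × ℝ)) : Set ((X × X × StrongDual ℝ X) × ℝ) :=
  {p | ∃ u s, ((p.1.1, u), s) ∈ E ∧ ((p.1.2.1, p.1.2.2 - u), p.2 - s) ∈ E'}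

/-- Compatibility of `E` with translations by functionals that vanish on `Y`. -/
def ShiftInvariant (E : Set ((X × StrongDual ℝ X) × ℝ)) (Y : Submodule ℝ X) (s : X) : Prop :=
  ∀ η : StrongDual ℝ X, (∀ y ∈ Y, η y = 0) →
    ∀ x u r, ((x, u), r) ∈ E → ((x, u + η), r + η s) ∈ E

theorem mem_fitzEpi {T : X → Set (StrongDual ℝ X)} {x : X} {u : StrongDual ℝ X} {r : ℝ} :
    ((x, u), r) ∈ fitzEpi T ↔ ∀ a, ∀ a' ∈ T a, u a + a' x - a' a ≤ r := by
  constructor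
  · intro h a a' ha
    exact h ((a, a'), a' a) ⟨ha, rfl⟩
  · rintro h ⟨⟨a, a'⟩, s⟩ ⟨h1, h2⟩
    simp only at h1 h2
    subst h2
    exact h a a' h1

theorem convex_conjEpi (E : Set ((X × StrongDual ℝ X) × ℝ)) : Convex ℝ (conjEpi E) := by
  intro p hp q hq a b ha hb hab e he
  have h1 := mul_le_mul_of_nonneg_left (hp e he) ha
  have h2 := mul_le_mul_of_nonneg_left (hq e he) hb
  obtain rfl : b = 1 - a := by linarith
  simp only [Prod.fst_add, Prod.snd_add, Prod.smul_fst, Prod.smul_snd, smul_eq_mul, map_add,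
    map_smul, add_apply, smul_apply]
  linarith

theorem isClosed_conjEpi (E : Set ((X × StrongDual ℝ X) × ℝ)) : IsClosed (conjEpi E) := by
  have : conjEpi E = ⋂ q ∈ E, {p : (X × StrongDual ℝ X) × ℝ |
      p.1.2 q.1.1 + q.1.2 p.1.1 - q.2 ≤ p.2} := by
    ext p; simp [conjEpi]
  rw [this]
  refine isClosed_biInter fun q _ => isClosed_le ?_ ?_
  · fun_prop
  · fun_prop

theorem shiftInvariant_conjEpi {E : Set ((X × StrongDual ℝ X) × ℝ)} {Y : Submodule ℝ X} {s : X}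
    (h : ∀ x ∈ epiDom E, x - s ∈ Y) : ShiftInvariant (conjEpi E) Y s := by
  rintro η hη x u r hxu ⟨⟨a, a'⟩, t⟩ he
  have h1 := hη _ (h a ⟨a', t, he⟩)
  have h2 := hxu _ he
  simp only [map_sub, add_apply] at h1 h2 ⊢
  linarith

theorem convex_epiInfConv {E E' : Set ((X × StrongDual ℝ X) × ℝ)} (hE : Convex ℝ E)
    (hE' : Convex ℝ E') : Convex ℝ (epiInfConv E E') := by
  rintro ⟨⟨x, y, x'⟩, r⟩ ⟨u, s, h1, h2⟩ ⟨⟨w, z, w'⟩, r'⟩ ⟨v, t, h3, h4⟩ a b ha hb hab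
  refine ⟨a • u + b • v, a • s + b • t, ?_, ?_⟩
  · exact hE h1 h3 ha hb hab
  · convert hE' h2 h4 ha hb hab using 1
    ext <;> simp <;> ring

theorem exists_eval_of_reflexive (hX : IsReflexiveSpace X)
    (L : StrongDual ℝ X →L[ℝ] ℝ) : ∃ w : X, ∀ u : StrongDual ℝ X, L u = u w := by
  obtain ⟨w, hw⟩ := hX L
  exact ⟨w, fun u => by rw [← hw]; rfl⟩

theorem mem_of_tendsto_weak (hX : IsReflexiveSpace X) {E : Set ((X × StrongDual ℝ X) × ℝ)}
    (hc : Convex ℝ E) (hcl : IsClosed E) {ι : Type*} {l : Filter ι} [l.NeBot]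
    {x : ι → X} {u : ι → StrongDual ℝ X} {s : ι → ℝ} {x₀ : X} {u₀ : StrongDual ℝ X} {s₀ : ℝ}
    (hx : Tendsto x l (𝓝 x₀)) (hu : ∀ w, Tendsto (fun i => u i w) l (𝓝 (u₀ w)))
    (hs : Tendsto s l (𝓝 s₀)) (h : ∀ i, ((x i, u i), s i) ∈ E) : ((x₀, u₀), s₀) ∈ E := by
  by_contra hn
  obtain ⟨L, t, h1, h2⟩ := geometric_hahn_banach_closed_point hc hcl hn
  obtain ⟨w, hw⟩ := exists_eval_of_reflexive hX
    ((L.comp (ContinuousLinearMap.inl ℝ _ _)).comp (ContinuousLinearMap.inr ℝ _ _))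
  have key : ∀ (a : X) (v : StrongDual ℝ X) (r : ℝ), L ((a, v), r) =
      L ((a, 0), 0) + v w + L (0, r) := by
    intro a v r
    rw [← hw v]
    simp only [ContinuousLinearMap.comp_apply, ContinuousLinearMap.inl_apply,
      ContinuousLinearMap.inr_apply]
    rw [← map_add, ← map_add]
    simp
  have hlim : Tendsto (fun i => L ((x i, u i), s i)) l (𝓝 (L ((x₀, u₀), s₀))) := by
    rw [key x₀, funext fun i => key (x i) (u i) (s i)]
    refine Tendsto.add (Tendsto.add ?_ (hu w)) ?_
    · exact ((by fun_prop : Continuous fun a : X => L ((a, 0), 0)).tendsto x₀).comp hx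
    · exact ((by fun_prop : Continuous fun r : ℝ => L (0, r)).tendsto s₀).comp hs
  have := le_of_tendsto hlim (Eventually.of_forall fun i => (h1 _ (h i)).le)
  linarith

theorem exists_bounded_representatives [CompleteSpace X] {Y : Submodule ℝ X}
    (hY : IsClosed (Y : Set X)) (u : ℕ → StrongDual ℝ X)
    (hb : ∀ y ∈ Y, ∃ B, ∀ n, u n y ≤ B) :
    ∃ (v : ℕ → StrongDual ℝ X) (B : ℝ), (∀ n, ‖v n‖ ≤ B) ∧ ∀ n, ∀ y ∈ Y, (v n - u n) y = 0 := by
  have : CompleteSpace Y := hY.completeSpace_coe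
  obtain ⟨B, hB⟩ := banach_steinhaus (g := fun n => (u n).comp Y.subtypeL) (by
    intro y
    obtain ⟨B₁, h₁⟩ := hb y y.2
    obtain ⟨B₂, h₂⟩ := hb (-y) (Y.neg_mem y.2)
    refine ⟨max B₁ B₂, fun n => ?_⟩
    rw [Real.norm_eq_abs, abs_le]
    have h3 := h₁ n
    have h4 := h₂ n
    have h5 := le_max_left B₁ B₂
    have h6 := le_max_right B₁ B₂
    simp only [map_neg, ContinuousLinearMap.comp_apply, Submodule.subtypeL_apply] at *
    constructor <;> linarith)
  choose v hv hv' using fun n => exists_extension_norm_eq Y ((u n).comp Y.subtypeL)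
  refine ⟨v, B, fun n => (hv' n).trans_le (hB n), fun n y hy => ?_⟩
  have := hv n ⟨y, hy⟩
  simp only [ContinuousLinearMap.comp_apply, Submodule.subtypeL_apply] at this
  simp [this]

theorem exists_ultrafilter_weakLimit (v : ℕ → StrongDual ℝ X) (s : ℕ → ℝ) {B c d : ℝ}
    (hv : ∀ n, ‖v n‖ ≤ B) (hs : ∀ n, s n ∈ Set.Icc c d) :
    ∃ (l : Filter ℕ) (v₀ : StrongDual ℝ X) (s₀ : ℝ), l.NeBot ∧ l ≤ atTop ∧
      (∀ w, Tendsto (fun n => v n w) l (𝓝 (v₀ w))) ∧ Tendsto s l (𝓝 s₀) := by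
  have hK := WeakDual.isCompact_closedBall (𝕜 := ℝ) (E := X) 0 B
  let U : Ultrafilter ℕ := Ultrafilter.of atTop
  obtain ⟨v₀, -, h₀⟩ := hK.ultrafilter_le_nhds
    (U.map fun n => StrongDual.toWeakDual (v n)) (by
      rw [le_principal_iff]
      refine Filter.mem_map.2 (Filter.univ_mem' fun n => ?_)
      simpa using hv n)
  obtain ⟨s₀, -, hs₀⟩ := (isCompact_Icc (a := c) (b := d)).ultrafilter_le_nhds (U.map s) (by
      rw [le_principal_iff]
      exact Filter.mem_map.2 (Filter.univ_mem' hs))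
  refine ⟨U, WeakDual.toStrongDual v₀, s₀, inferInstance, Ultrafilter.of_le _, fun w => ?_, hs₀⟩
  have h1 : Tendsto (fun n => StrongDual.toWeakDual (v n)) U (𝓝 v₀) := h₀
  exact ((WeakDual.eval_continuous w).tendsto v₀).comp h1

theorem isClosed_epiInfConv [CompleteSpace X] (hX : IsReflexiveSpace X)
    {E E' : Set ((X × StrongDual ℝ X) × ℝ)} (hE : Convex ℝ E) (hE' : Convex ℝ E')
    (hcl : IsClosed E) (hcl' : IsClosed E') {Y : Submodule ℝ X} (hY : IsClosed (Y : Set X))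
    {a b : X} (hab : a - b ∈ Y) (hinv : ShiftInvariant E Y a) (hinv' : ShiftInvariant E' Y b)
    (hcone : ∀ y ∈ Y, ∃ t : ℝ, 0 ≤ t ∧ ∃ p ∈ epiDom (conjEpi E), ∃ q ∈ epiDom (conjEpi E'),
      y = t • (p - q)) : IsClosed (epiInfConv E E') := by
  refine IsSeqClosed.isClosed ?_
  rintro z ⟨⟨x₀, y₀, ξ₀⟩, r₀⟩ hz hlim
  choose u s h1 h2 using hz
  have hx : Tendsto (fun n => (z n).1.1) atTop (𝓝 x₀) := hlim.fst_nhds.fst_nhds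
  have hy : Tendsto (fun n => (z n).1.2.1) atTop (𝓝 y₀) := hlim.fst_nhds.snd_nhds.fst_nhds
  have hξ : Tendsto (fun n => (z n).1.2.2) atTop (𝓝 ξ₀) := hlim.fst_nhds.snd_nhds.snd_nhds
  have hr : Tendsto (fun n => (z n).2) atTop (𝓝 r₀) := hlim.snd_nhds
  have bdd : ∀ (f : ℕ → ℝ) (c : ℝ), Tendsto f atTop (𝓝 c) → ∃ M, ∀ n, |f n| ≤ M := by
    intro f c hf
    obtain ⟨M, hM⟩ := (Metric.isBounded_range_of_tendsto f hf).exists_norm_le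
    exact ⟨M, fun n => hM _ ⟨n, rfl⟩⟩
  have hbY : ∀ y ∈ Y, ∃ B, ∀ n, u n y ≤ B := by
    intro y hyY
    obtain ⟨t, ht, p, ⟨p', κ, hp⟩, q, ⟨q', κ', hq⟩, rfl⟩ := hcone y hyY
    obtain ⟨M, hM⟩ := bdd (fun n => (z n).2 - (z n).1.2.2 q - p' (z n).1.1 - q' (z n).1.2.1) _
      (((hr.sub ((by fun_prop : Continuous fun ξ : StrongDual ℝ X => ξ q).tendsto ξ₀ |>.comp
        hξ)).sub ((p'.continuous.tendsto x₀).comp hx)).sub ((q'.continuous.tendsto y₀).comp hy))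
    refine ⟨t * (M + κ + κ'), fun n => ?_⟩
    rw [map_smul, smul_eq_mul]
    refine mul_le_mul_of_nonneg_left ?_ ht
    have e1 := hp _ (h1 n)
    have e2 := hq _ (h2 n)
    have e3 := (abs_le.1 (hM n)).2
    simp only [sub_apply, map_sub] at *
    linarith
  obtain ⟨v, B, hvB, hv⟩ := exists_bounded_representatives hY u hbY
  have k1 : ∀ n, (((z n).1.1, v n), s n + (v n - u n) a) ∈ E := fun n => by
    simpa using hinv _ (hv n) _ _ _ (h1 n)
  have k2 : ∀ n, (((z n).1.2.1, (z n).1.2.2 - v n), (z n).2 - (s n + (v n - u n) a)) ∈ E' := by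
    intro n
    have hη : ∀ y ∈ Y, (-(v n - u n)) y = 0 := fun y hy => by
      rw [neg_apply, hv n y hy, neg_zero]
    have e := hinv' _ hη _ _ _ (h2 n)
    have e2 := hv n _ hab
    rw [map_sub] at e2
    convert e using 2
    · congr 1; abel
    · simp only [neg_apply]; linarith
  set σ : ℕ → ℝ := fun n => s n + (v n - u n) a with hσ
  obtain ⟨_, _, p, ⟨p', κ, hp⟩, q, ⟨q', κ', hq⟩, -⟩ := hcone 0 Y.zero_mem
  obtain ⟨M₁, hM₁⟩ := bdd _ _ ((p'.continuous.tendsto x₀).comp hx)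
  obtain ⟨M₂, hM₂⟩ := bdd (fun n => (z n).2 - (z n).1.2.2 q - q' (z n).1.2.1) _
    ((hr.sub ((by fun_prop : Continuous fun ξ : StrongDual ℝ X => ξ q).tendsto ξ₀ |>.comp
        hξ)).sub ((q'.continuous.tendsto y₀).comp hy))
  have hvn : ∀ (w : X) n, |v n w| ≤ B * ‖w‖ := fun w n =>
    ((v n).le_opNorm w).trans (mul_le_mul_of_nonneg_right (hvB n) (norm_nonneg _))
  have hσI : ∀ n, σ n ∈ Set.Icc (-(B * ‖p‖) - M₁ - κ) (M₂ + B * ‖q‖ + κ') := by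
    intro n
    have e1 := hp _ (k1 n)
    have e2 := hq _ (k2 n)
    have e3 := (abs_le.1 (hM₁ n)).1
    have e4 := (abs_le.1 (hM₂ n)).2
    have e5 := (abs_le.1 (hvn p n)).1
    have e6 := (abs_le.1 (hvn q n)).2
    simp only [sub_apply, Function.comp_apply, hσ] at *
    constructor <;> linarith
  obtain ⟨l, v₀, s₀, hl, hle, hw, hs⟩ := exists_ultrafilter_weakLimit v σ hvB hσI
  refine ⟨v₀, s₀, ?_, ?_⟩
  · exact mem_of_tendsto_weak hX hE hcl (hx.mono_left hle) hw hs k1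
  · refine mem_of_tendsto_weak hX hE' hcl' (hy.mono_left hle) (fun w => ?_)
      ((hr.mono_left hle).sub hs) k2
    simp only [sub_apply]
    exact (((by fun_prop : Continuous fun ξ : StrongDual ℝ X => ξ w).tendsto ξ₀).comp
      (hξ.mono_left hle)).sub (hw w)

end Epigraphs

section FenchelDuality

variable {X : Type*} [NormedAddCommGroup X] [NormedSpace ℝ X]

theorem norm_sq_combo_le {V : Type*} [NormedAddCommGroup V] [NormedSpace ℝ V] (x y : V) {a b : ℝ}
    (ha : 0 ≤ a) (hb : 0 ≤ b) (hab : a + b = 1) :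
    ‖a • x + b • y‖ ^ 2 ≤ a * ‖x‖ ^ 2 + b * ‖y‖ ^ 2 := by
  have h1 : ‖a • x + b • y‖ ≤ a * ‖x‖ + b * ‖y‖ := by
    refine (norm_add_le _ _).trans_eq ?_
    rw [norm_smul, norm_smul, Real.norm_of_nonneg ha, Real.norm_of_nonneg hb]
  have h2 := pow_le_pow_left₀ (norm_nonneg _) h1 2
  obtain rfl : b = 1 - a := by linarith
  nlinarith [mul_nonneg (mul_nonneg ha hb) (sq_nonneg (‖x‖ - ‖y‖))]

theorem neg_half_norm_sq_le_apply (f : StrongDual ℝ X) (x : X) :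
    -‖x‖ ^ 2 / 2 - ‖f‖ ^ 2 / 2 ≤ f x := by
  have h := (abs_le.1 (f.le_opNorm x)).1
  nlinarith [sq_nonneg (‖f‖ - ‖x‖)]

theorem half_norm_sq_add_le_of_forall_le {f : StrongDual ℝ X} {y : X} {K : ℝ}
    (h : ∀ (w : X) (α : StrongDual ℝ X), f w + α y ≤ ‖w‖ ^ 2 / 2 + ‖α‖ ^ 2 / 2 + K) :
    ‖y‖ ^ 2 / 2 + ‖f‖ ^ 2 / 2 ≤ K := by
  obtain ⟨g, hg, hgy⟩ := exists_dual_vector'' ℝ y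
  have hα : ‖‖y‖ • g‖ ^ 2 ≤ ‖y‖ ^ 2 := by
    rw [norm_smul, norm_norm]
    exact pow_le_pow_left₀ (by positivity) (mul_le_of_le_one_right (norm_nonneg _) hg) 2
  have h1 : ∀ w, f w ≤ ‖w‖ ^ 2 / 2 + (K - ‖y‖ ^ 2 / 2) := by
    intro w
    have := h w (‖y‖ • g)
    simp only [smul_apply, smul_eq_mul, hgy, RCLike.ofReal_real_eq_id, id] at this
    nlinarith
  have hK : 0 ≤ K - ‖y‖ ^ 2 / 2 := by simpa using h1 0
  have h2 : ‖f‖ ≤ √(2 * (K - ‖y‖ ^ 2 / 2)) := by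
    refine f.opNorm_le_bound (Real.sqrt_nonneg _) fun w => ?_
    rcases eq_or_ne w 0 with rfl | hw
    · simp
    have hw' : 0 < ‖w‖ ^ 2 := by positivity
    have h3 := h1 ((f w / ‖w‖ ^ 2) • w)
    rw [map_smul, smul_eq_mul, norm_smul, mul_pow, Real.norm_eq_abs, sq_abs] at h3
    have h4 : f w / ‖w‖ ^ 2 * f w = f w ^ 2 / ‖w‖ ^ 2 := by ring
    have h5 : (f w / ‖w‖ ^ 2) ^ 2 * ‖w‖ ^ 2 = f w ^ 2 / ‖w‖ ^ 2 := by field_simp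
    rw [h4, h5] at h3
    have h6 : f w ^ 2 / ‖w‖ ^ 2 ≤ 2 * (K - ‖y‖ ^ 2 / 2) := by linarith
    rw [div_le_iff₀ hw'] at h6
    rw [Real.norm_eq_abs, ← Real.sqrt_sq (norm_nonneg w), ← Real.sqrt_mul (by linarith)]
    exact Real.abs_le_sqrt h6
  have h3 : ‖f‖ ^ 2 ≤ 2 * (K - ‖y‖ ^ 2 / 2) := by
    rw [← Real.sq_sqrt (by linarith : (0 : ℝ) ≤ 2 * (K - ‖y‖ ^ 2 / 2))]
    exact pow_le_pow_left₀ (norm_nonneg _) h2 2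
  linarith

/-- Fenchel duality between a convex majorant of the coupling function and half the sum of the
squared norms. -/
theorem exists_conj_le_neg_half_norm_sq (hX : IsReflexiveSpace X)
    {H : Set ((X × StrongDual ℝ X) × ℝ)} (hc : Convex ℝ H) (hne : H.Nonempty)
    (hle : ∀ w α ρ, ((w, α), ρ) ∈ H → α w ≤ ρ) :
    ∃ (x : X) (u : StrongDual ℝ X), ∀ w α ρ, ((w, α), ρ) ∈ H →
      u w + α x - ρ ≤ -(‖x‖ ^ 2 / 2 + ‖u‖ ^ 2 / 2) := by
  let B : Set ((X × StrongDual ℝ X) × ℝ) := {p | p.2 < -‖p.1.1‖ ^ 2 / 2 - ‖p.1.2‖ ^ 2 / 2}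
  have hBo : IsOpen B := isOpen_lt (by fun_prop) (by fun_prop)
  have hBc : Convex ℝ B := by
    rintro ⟨⟨w, α⟩, ρ⟩ h1 ⟨⟨w', α'⟩, ρ'⟩ h2 a b ha hb hab
    have e1 := norm_sq_combo_le w w' ha hb hab
    have e2 := norm_sq_combo_le α α' ha hb hab
    simp only [B, Set.mem_ofPred_eq, Prod.smul_mk, Prod.mk_add_mk, smul_eq_mul] at *
    have e3 : a * ρ + b * ρ' < a * (-‖w‖ ^ 2 / 2 - ‖α‖ ^ 2 / 2) +
        b * (-‖w'‖ ^ 2 / 2 - ‖α'‖ ^ 2 / 2) := by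
      rcases ha.eq_or_lt with rfl | ha
      · obtain rfl : b = 1 := by linarith
        linarith
      · have := mul_lt_mul_of_pos_left h1 ha
        have := mul_le_mul_of_nonneg_left h2.le hb
        linarith
    linarith
  have hdisj : Disjoint B H := by
    rw [Set.disjoint_left]
    rintro ⟨⟨w, α⟩, ρ⟩ h1 h2
    have := hle _ _ _ h2
    have := neg_half_norm_sq_le_apply α w
    simp only [B, Set.mem_ofPred_eq] at h1
    linarith
  obtain ⟨L, t, h1, h2⟩ := geometric_hahn_banach_open hBc hBo hc hdisj
  obtain ⟨y, hy⟩ := exists_eval_of_reflexive hX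
    ((L.comp (ContinuousLinearMap.inl ℝ _ _)).comp (ContinuousLinearMap.inr ℝ _ _))
  set f : StrongDual ℝ X :=
    (L.comp (ContinuousLinearMap.inl ℝ _ _)).comp (ContinuousLinearMap.inl ℝ _ _) with hf
  set τ : ℝ := L (0, 1) with hτ
  have key : ∀ w α ρ, L ((w, α), ρ) = f w + α y + ρ * τ := by
    intro w α ρ
    rw [← hy α, hτ, ← smul_eq_mul, ← map_smul]
    simp only [hf, ContinuousLinearMap.comp_apply, ContinuousLinearMap.inl_apply,
      ContinuousLinearMap.inr_apply]
    rw [← map_add, ← map_add]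
    simp
  have hB : ∀ (w : X) (α : StrongDual ℝ X) (ρ : ℝ), ρ < -‖w‖ ^ 2 / 2 - ‖α‖ ^ 2 / 2 → f w + α y + ρ * τ < t :=
    fun w α ρ h => key w α ρ ▸ h1 ((w, α), ρ) h
  have hH : ∀ w α ρ, ((w, α), ρ) ∈ H → t ≤ f w + α y + ρ * τ :=
    fun w α ρ h => key w α ρ ▸ h2 ((w, α), ρ) h
  have hτ0 : 0 < τ := by
    obtain ⟨⟨⟨w, α⟩, ρ⟩, h⟩ := hne
    have e1 := hH _ _ _ h
    have e2 := hB w α (-‖w‖ ^ 2 / 2 - ‖α‖ ^ 2 / 2 - 1) (by linarith)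
    have e3 := (neg_half_norm_sq_le_apply α w).trans (hle _ _ _ h)
    by_contra hn
    nlinarith
  have hsup : ‖τ⁻¹ • y‖ ^ 2 / 2 + ‖τ⁻¹ • f‖ ^ 2 / 2 ≤ t / τ := by
    refine half_norm_sq_add_le_of_forall_le fun w α => le_of_forall_pos_le_add fun ε hε => ?_
    have := (hB w α (-‖w‖ ^ 2 / 2 - ‖α‖ ^ 2 / 2 - ε) (by linarith)).le
    have e : τ⁻¹ * (f w + α y + (-‖w‖ ^ 2 / 2 - ‖α‖ ^ 2 / 2 - ε) * τ) ≤ τ⁻¹ * t :=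
      mul_le_mul_of_nonneg_left this (inv_pos.2 hτ0).le
    have e2 : τ⁻¹ * (f w + α y + (-‖w‖ ^ 2 / 2 - ‖α‖ ^ 2 / 2 - ε) * τ) =
        τ⁻¹ * f w + τ⁻¹ * α y + (-‖w‖ ^ 2 / 2 - ‖α‖ ^ 2 / 2 - ε) := by field_simp
    rw [e2] at e
    simp only [smul_apply, map_smul, smul_eq_mul, div_eq_inv_mul t]
    linarith
  refine ⟨-(τ⁻¹ • y), -(τ⁻¹ • f), fun w α ρ h => ?_⟩
  have e : τ⁻¹ * t ≤ τ⁻¹ * (f w + α y + ρ * τ) :=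
    mul_le_mul_of_nonneg_left (hH _ _ _ h) (inv_pos.2 hτ0).le
  have e2 : τ⁻¹ * (f w + α y + ρ * τ) = τ⁻¹ * f w + τ⁻¹ * α y + ρ := by field_simp
  rw [e2, ← div_eq_inv_mul t] at e
  simp only [norm_neg, neg_apply, smul_apply, map_neg, map_smul, smul_eq_mul]
  linarith

theorem exists_conj_le_coupling_sub (hX : IsReflexiveSpace X)
    {H : Set ((X × StrongDual ℝ X) × ℝ)} (hc : Convex ℝ H) (hne : H.Nonempty)
    (hle : ∀ w α ρ, ((w, α), ρ) ∈ H → α w ≤ ρ) (z : X) (z' : StrongDual ℝ X) :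
    ∃ (x : X) (u : StrongDual ℝ X), ∀ w α ρ, ((w, α), ρ) ∈ H →
      u w + α x - ρ ≤ u x - ((u - z') (x - z) + ‖x - z‖ ^ 2 / 2 + ‖u - z'‖ ^ 2 / 2) := by
  let A : Set ((X × StrongDual ℝ X) × ℝ) :=
    {p | ((p.1.1 + z, p.1.2 + z'), p.2 + z' p.1.1 + p.1.2 z + z' z) ∈ H}
  have hAc : Convex ℝ A := by
    rintro ⟨⟨w, α⟩, ρ⟩ h1 ⟨⟨w', α'⟩, ρ'⟩ h2 a b ha hb hab
    have := hc h1 h2 ha hb hab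
    simp only [A, Set.mem_ofPred_eq, Prod.smul_mk, Prod.mk_add_mk, smul_eq_mul] at *
    obtain rfl : b = 1 - a := by linarith
    convert this using 1
    ext
    · simp only [smul_add]; module
    · simp only [add_apply, smul_apply, smul_eq_mul]; ring
    · simp only [add_apply, smul_apply, map_add, map_smul, smul_eq_mul]; ring
  have hAmem : ∀ w α ρ, ((w, α), ρ) ∈ H →
      ((w - z, α - z'), ρ - z' (w - z) - (α - z') z - z' z) ∈ A := by
    intro w α ρ h
    simp only [A, Set.mem_ofPred_eq, sub_add_cancel]
    convert h using 2
    ring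
  have hAle : ∀ w α ρ, ((w, α), ρ) ∈ A → α w ≤ ρ := by
    intro w α ρ h
    have := hle _ _ _ h
    simp only [add_apply, map_add] at this
    linarith
  obtain ⟨⟨⟨w₀, α₀⟩, ρ₀⟩, h₀⟩ := hne
  obtain ⟨x, u, hxu⟩ := exists_conj_le_neg_half_norm_sq hX hAc ⟨_, hAmem _ _ _ h₀⟩ hAle
  refine ⟨x + z, u + z', fun w α ρ h => ?_⟩
  have := hxu _ _ _ (hAmem _ _ _ h)
  simp only [add_sub_cancel_right, add_apply, sub_apply, map_add, map_sub] at *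
  linarith

end FenchelDuality

section MaximalMonotone

variable {X : Type*} [NormedAddCommGroup X] [NormedSpace ℝ X] {T : X → Set (StrongDual ℝ X)}

theorem IsMaximalMonotoneOp.mem_of_related (hT : IsMaximalMonotoneOp T) {x : X}
    {u : StrongDual ℝ X} (h : ∀ a, ∀ a' ∈ T a, 0 ≤ (u - a') (x - a)) : u ∈ T x := by
  have hS := hT.2 (fun a => T a ∪ {v | a = x ∧ v = u}) (by
    rintro a b a' (ha | ⟨rfl, rfl⟩) b' (hb | ⟨rfl, rfl⟩)
    · exact hT.1 a b a' ha b' hb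
    · exact h a a' ha
    · have := h b b' hb
      simp only [sub_apply, map_sub] at this ⊢
      linarith
    · simp) fun a => Set.subset_union_left
  rw [← congrFun hS x]
  exact Or.inr ⟨rfl, rfl⟩

theorem isMaximalMonotoneOp_of_related (hT : IsMonotoneOp T)
    (h : ∀ x u, (∀ a, ∀ a' ∈ T a, 0 ≤ (u - a') (x - a)) → u ∈ T x) :
    IsMaximalMonotoneOp T := by
  refine ⟨hT, fun S hS hTS => funext fun x => Set.Subset.antisymm (fun u hu => ?_) (hTS x)⟩
  exact h x u fun a a' ha => hS a x a' (hTS a ha) u hu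

theorem IsMaximalMonotoneOp.nonempty_opDom (hT : IsMaximalMonotoneOp T) : (opDom T).Nonempty := by
  by_contra hn
  have h : ∀ a, ∀ a' ∈ T a, False := fun a a' ha => hn ⟨a, a', ha⟩
  exact h 0 0 (hT.mem_of_related fun a a' ha => (h a a' ha).elim)

theorem IsMaximalMonotoneOp.apply_le_of_mem_fitzEpi (hT : IsMaximalMonotoneOp T) {x : X}
    {u : StrongDual ℝ X} {r : ℝ} (h : ((x, u), r) ∈ fitzEpi T) : u x ≤ r := by
  rw [mem_fitzEpi] at h
  by_contra! hr
  have hu : u ∈ T x := hT.mem_of_related fun a a' ha => by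
    have := h a a' ha
    simp only [sub_apply, map_sub]
    linarith
  have := h x u hu
  linarith

theorem IsMaximalMonotoneOp.mem_of_mem_fitzEpi (hT : IsMaximalMonotoneOp T) {x : X}
    {u : StrongDual ℝ X} (h : ((x, u), u x) ∈ fitzEpi T) : u ∈ T x := by
  rw [mem_fitzEpi] at h
  refine hT.mem_of_related fun a a' ha => ?_
  have := h a a' ha
  simp only [sub_apply, map_sub]
  linarith

theorem IsMonotoneOp.mem_fitzEpi_of_mem (hT : IsMonotoneOp T) {x : X} {u : StrongDual ℝ X}
    (hu : u ∈ T x) : ((x, u), u x) ∈ fitzEpi T := by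
  rw [mem_fitzEpi]
  intro a a' ha
  have := hT a x a' ha u hu
  simp only [sub_apply, map_sub] at this
  linarith

theorem IsMonotoneOp.couplingGraph_subset (hT : IsMonotoneOp T) :
    couplingGraph T ⊆ fitzEpi T := by
  rintro ⟨⟨x, u⟩, r⟩ ⟨h1, h2⟩
  simp only at h1 h2
  subst h2
  exact hT.mem_fitzEpi_of_mem h1

theorem subset_conjEpi_conjEpi (E : Set ((X × StrongDual ℝ X) × ℝ)) :
    E ⊆ conjEpi (conjEpi E) := by
  intro p hp q hq
  have := hq p hp
  linarith

theorem conjEpi_anti {E E' : Set ((X × StrongDual ℝ X) × ℝ)} (h : E ⊆ E') :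
    conjEpi E' ⊆ conjEpi E := fun _ hp q hq => hp q (h hq)

theorem epiDom_mono {E E' : Set ((X × StrongDual ℝ X) × ℝ)} (h : E ⊆ E') :
    epiDom E ⊆ epiDom E' := fun _ ⟨u, r, hp⟩ => ⟨u, r, h hp⟩

theorem opDom_subset_epiDom_couplingGraph (T : X → Set (StrongDual ℝ X)) :
    opDom T ⊆ epiDom (couplingGraph T) := fun x ⟨u, hu⟩ => ⟨u, u x, hu, rfl⟩

theorem exists_annihilator_apply_ne_zero {Y : Submodule ℝ X} (hY : IsClosed (Y : Set X)) {x : X}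
    (hx : x ∉ Y) : ∃ η : StrongDual ℝ X, (∀ y ∈ Y, η y = 0) ∧ η x ≠ 0 := by
  obtain ⟨f, t, h1, h2⟩ := geometric_hahn_banach_closed_point Y.convex hY hx
  have h0 : ∀ y ∈ Y, f y = 0 := by
    intro y hy
    by_contra hn
    have := h1 ((t / f y) • y) (Y.smul_mem _ hy)
    rw [map_smul, smul_eq_mul, div_mul_cancel₀ _ hn] at this
    exact lt_irrefl _ this
  refine ⟨f, h0, ?_⟩
  have := h1 0 Y.zero_mem
  rw [map_zero] at this
  linarith

theorem IsMaximalMonotoneOp.add_mem_of_annihilator (hT : IsMaximalMonotoneOp T)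
    {Y : Submodule ℝ X} {s : X} (hs : ∀ x ∈ opDom T, x - s ∈ Y) {η : StrongDual ℝ X}
    (hη : ∀ y ∈ Y, η y = 0) {a : X} {a' : StrongDual ℝ X} (ha : a' ∈ T a) : a' + η ∈ T a := by
  refine hT.mem_of_related fun b b' hb => ?_
  have h1 := hT.1 b a b' hb a' ha
  have h2 := hη _ (hs a ⟨a', ha⟩)
  have h3 := hη _ (hs b ⟨b', hb⟩)
  simp only [add_apply, sub_apply, map_sub] at *
  linarith

theorem IsMaximalMonotoneOp.sub_mem_of_mem_epiDom_fitzEpi (hT : IsMaximalMonotoneOp T)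
    {Y : Submodule ℝ X} (hY : IsClosed (Y : Set X)) {s : X} (hs : ∀ x ∈ opDom T, x - s ∈ Y)
    {x : X} (hx : x ∈ epiDom (fitzEpi T)) : x - s ∈ Y := by
  by_contra hn
  obtain ⟨η, hη, hηx⟩ := exists_annihilator_apply_ne_zero hY hn
  obtain ⟨b, b', hb⟩ := hT.nonempty_opDom
  obtain ⟨u, r, h⟩ := hx
  rw [mem_fitzEpi] at h
  have h1 := hη _ (hs b ⟨b', hb⟩)
  have h2 := h b (b' + ((r - u b - b' x + b' b + 1) / η (x - s)) • η)
    (hT.add_mem_of_annihilator hs (fun y hy => by simp [hη y hy]) hb)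
  have h3 : η (x - s) = η x - η b := by rw [map_sub] at *; linarith
  have h4 := div_mul_cancel₀ (r - u b - b' x + b' b + 1) hηx
  simp only [add_apply, smul_apply, smul_eq_mul] at h2
  generalize (r - u b - b' x + b' b + 1) / η (x - s) = k at *
  rw [h3] at h4
  linarith

end MaximalMonotone

section SumTheorem

variable {X : Type*} [NormedAddCommGroup X] [NormedSpace ℝ X] {S T : X → Set (StrongDual ℝ X)}

theorem exists_forall_le_and_forall_le_sub {A B : Set ℝ} (hA : A.Nonempty) (hB : B.Nonempty)
    {t : ℝ} (h : ∀ a ∈ A, ∀ b ∈ B, a + b ≤ t) :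
    ∃ s, (∀ a ∈ A, a ≤ s) ∧ ∀ b ∈ B, b ≤ t - s := by
  obtain ⟨b₀, hb₀⟩ := hB
  refine ⟨sSup A, fun a ha => le_csSup ⟨t - b₀, fun a ha => ?_⟩ ha, fun b hb => ?_⟩
  · linarith [h a ha b₀ hb₀]
  · have : sSup A ≤ t - b := csSup_le hA fun a ha => by linarith [h a ha b hb]
    linarith

/-- A range condition for `S + T`, under a constraint qualification on the domains of the
Fitzpatrick functions. -/
theorem exists_mem_add_of_qualification [CompleteSpace X] (hX : IsReflexiveSpace X)
    (hS : IsMaximalMonotoneOp S) (hT : IsMaximalMonotoneOp T)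
    {Y : Submodule ℝ X} (hY : IsClosed (Y : Set X))
    (hsub : ∀ x ∈ opDom S, ∀ y ∈ opDom T, x - y ∈ Y)
    (hcone : ∀ y ∈ Y, ∃ t : ℝ, 0 ≤ t ∧ ∃ p ∈ epiDom (fitzEpi S), ∃ q ∈ epiDom (fitzEpi T),
      y = t • (p - q))
    (hcommon : (epiDom (fitzEpi S) ∩ epiDom (fitzEpi T)).Nonempty)
    (z : X) (z' : StrongDual ℝ X) :
    ∃ x, ∃ u ∈ S x, ∃ v ∈ T x,
      (u + v - z') (x - z) + ‖x - z‖ ^ 2 / 2 + ‖u + v - z'‖ ^ 2 / 2 ≤ 0 := by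
  obtain ⟨a, ha⟩ := hS.nonempty_opDom
  obtain ⟨b, hb⟩ := hT.nonempty_opDom
  have hSa : ∀ x ∈ epiDom (fitzEpi S), x - a ∈ Y := fun x hx =>
    hS.sub_mem_of_mem_epiDom_fitzEpi hY (fun w hw => by
      simpa using Y.sub_mem (hsub w hw b hb) (hsub a ha b hb)) hx
  have hTb : ∀ x ∈ epiDom (fitzEpi T), x - b ∈ Y := fun x hx =>
    hT.sub_mem_of_mem_epiDom_fitzEpi hY (fun w hw => by
      simpa using Y.sub_mem (hsub a ha b hb) (hsub a ha w hw)) hx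
  have hΨc : Convex ℝ (epiInfConv (conjEpi (fitzEpi S)) (conjEpi (fitzEpi T))) :=
    convex_epiInfConv (convex_conjEpi _) (convex_conjEpi _)
  have hΨ : IsClosed (epiInfConv (conjEpi (fitzEpi S)) (conjEpi (fitzEpi T))) := by
    refine isClosed_epiInfConv hX (convex_conjEpi _) (convex_conjEpi _) (isClosed_conjEpi _)
      (isClosed_conjEpi _) hY (hsub a ha b hb) (shiftInvariant_conjEpi hSa)
      (shiftInvariant_conjEpi hTb) fun y hy => ?_
    obtain ⟨t, ht, p, hp, q, hq, rfl⟩ := hcone y hy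
    exact ⟨t, ht, p, epiDom_mono (subset_conjEpi_conjEpi _) hp, q,
      epiDom_mono (subset_conjEpi_conjEpi _) hq, rfl⟩
  let H : Set ((X × StrongDual ℝ X) × ℝ) :=
    {p | ∃ u s, ((p.1.1, u), s) ∈ fitzEpi S ∧ ((p.1.1, p.1.2 - u), p.2 - s) ∈ fitzEpi T}
  have hHc : Convex ℝ H := fun p hp q hq c d hc hd hcd =>
    convex_epiInfConv (convex_conjEpi (couplingGraph S)) (convex_conjEpi (couplingGraph T))
      (x := ((p.1.1, p.1.1, p.1.2), p.2)) hp (y := ((q.1.1, q.1.1, q.1.2), q.2)) hq hc hd hcd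
  have hHmem : ∀ w α β s t, ((w, α), s) ∈ fitzEpi S → ((w, β), t) ∈ fitzEpi T →
      ((w, α + β), s + t) ∈ H := fun w α β s t h1 h2 => ⟨α, s, h1, by simpa using h2⟩
  obtain ⟨w₀, ⟨α₀, s₀, hα₀⟩, β₀, t₀, hβ₀⟩ := hcommon
  obtain ⟨x, x', hx⟩ := exists_conj_le_coupling_sub hX hHc ⟨_, hHmem _ _ _ _ _ hα₀ hβ₀⟩
    (by
      rintro w α ρ ⟨u, s, h1, h2⟩
      have e1 := hS.apply_le_of_mem_fitzEpi h1
      have e2 := hT.apply_le_of_mem_fitzEpi h2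
      simp only [sub_apply] at e2
      linarith) z z'
  set R : ℝ := (x' - z') (x - z) + ‖x - z‖ ^ 2 / 2 + ‖x' - z'‖ ^ 2 / 2 with hR
  have hmem : ((x, x, x'), x' x - R) ∈ epiInfConv (conjEpi (fitzEpi S)) (conjEpi (fitzEpi T)) := by
    by_contra hn
    obtain ⟨L, t, h1, h2⟩ := geometric_hahn_banach_closed_point hΨc hΨ hn
    let i₁ : X →L[ℝ] (X × X × StrongDual ℝ X) × ℝ :=
      (ContinuousLinearMap.inl ℝ _ _).comp (ContinuousLinearMap.inl ℝ _ _)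
    let i₂ : X →L[ℝ] (X × X × StrongDual ℝ X) × ℝ :=
      (ContinuousLinearMap.inl ℝ _ _).comp ((ContinuousLinearMap.inr ℝ _ _).comp
        (ContinuousLinearMap.inl ℝ _ _))
    let i₃ : StrongDual ℝ X →L[ℝ] (X × X × StrongDual ℝ X) × ℝ :=
      (ContinuousLinearMap.inl ℝ _ _).comp ((ContinuousLinearMap.inr ℝ _ _).comp
        (ContinuousLinearMap.inr ℝ _ _))
    obtain ⟨w, hw⟩ := exists_eval_of_reflexive hX (L.comp i₃)
    set α : StrongDual ℝ X := L.comp i₁ with hα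
    set β : StrongDual ℝ X := L.comp i₂ with hβ
    set τ : ℝ := L (0, 1) with hτ
    have key : ∀ x₁ x₂ ξ r, L ((x₁, x₂, ξ), r) = α x₁ + β x₂ + ξ w + r * τ := by
      intro x₁ x₂ ξ r
      rw [← hw ξ, hτ, ← smul_eq_mul, ← map_smul]
      simp only [hα, hβ, ContinuousLinearMap.comp_apply, i₁, i₂, i₃,
        ContinuousLinearMap.inl_apply, ContinuousLinearMap.inr_apply]
      rw [← map_add, ← map_add, ← map_add]
      simp
    rw [key] at h2
    have hup : ∀ c ∈ opDom S, ∀ d ∈ opDom T, ∀ c' ∈ S c, ∀ d' ∈ T d, ∀ k : ℝ, 0 ≤ k →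
        α c + β d + (c' w + d' w) + (c' c + d' d + k) * τ < t := by
      intro c _ d _ c' hc' d' hd' k hk
      have e1 := subset_conjEpi_conjEpi (couplingGraph S) (a := ((c, c'), c' c)) ⟨hc', rfl⟩
      have e2 := subset_conjEpi_conjEpi (couplingGraph T) (a := ((d, d'), d' d)) ⟨hd', rfl⟩
      have e3 : ((d, d'), d' d + k) ∈ conjEpi (fitzEpi T) := fun q hq =>
        (e2 q hq).trans (le_add_of_nonneg_right hk)
      have := h1 ((c, d, c' + d'), c' c + d' d + k) ⟨c', c' c, e1, by
        convert e3 using 2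
        · simp
        · ring⟩
      rw [key] at this
      simpa using this
    obtain ⟨a', ha'⟩ := id ha
    obtain ⟨b', hb'⟩ := id hb
    have hτ0 : τ ≤ 0 := by
      by_contra! hpos
      have h0 := hup a ha b hb a' ha' b' hb' 0 le_rfl
      have h3 := hup a ha b hb a' ha' b' hb'
        ((t - (α a + β b + (a' w + b' w) + (a' a + b' b + 0) * τ)) / τ)
        (div_nonneg (by linarith) hpos.le)
      have h4 := div_mul_cancel₀ (t - (α a + β b + (a' w + b' w) + (a' a + b' b + 0) * τ)) hpos.ne'
      rw [add_mul _ _ τ] at h3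
      linarith
    obtain ⟨σ, hσ, hσ'⟩ := exists_forall_le_and_forall_le_sub (t := t)
      (A := {r | ∃ c, ∃ c' ∈ S c, r = α c + c' w + c' c * τ})
      (B := {r | ∃ d, ∃ d' ∈ T d, r = β d + d' w + d' d * τ})
      ⟨_, a, a', ha', rfl⟩ ⟨_, b, b', hb', rfl⟩ (by
        rintro _ ⟨c, c', hc, rfl⟩ _ ⟨d, d', hd, rfl⟩
        have := hup c ⟨c', hc⟩ d ⟨d', hd⟩ c' hc d' hd 0 le_rfl
        linarith)
    have hk : ∀ k : ℝ, 0 ≤ k → k * (α x + β x + x' w - t + τ * (x' x - R)) ≤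
        x' x - R - (x' w₀ + α₀ x + β₀ x - s₀ - t₀) := by
      intro k hk
      have hμ : 0 < 1 - k * τ := by nlinarith
      have e1 : (((1 - k * τ)⁻¹ • (w₀ + k • w), (1 - k * τ)⁻¹ • (α₀ + k • α)),
          (1 - k * τ)⁻¹ * (s₀ + k * σ)) ∈ fitzEpi S := by
        rw [mem_fitzEpi] at hα₀ ⊢
        intro c c' hc
        have f1 := hα₀ c c' hc
        have f2 := mul_le_mul_of_nonneg_left (hσ _ ⟨c, c', hc, rfl⟩) hk
        refine le_trans (le_of_eq ?_) (mul_le_mul_of_nonneg_left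
          (by linarith : α₀ c + k * α c + (c' w₀ + k * c' w) - (1 - k * τ) * c' c ≤ s₀ + k * σ)
          (inv_pos.2 hμ).le)
        simp only [smul_apply, add_apply, map_smul, map_add, smul_eq_mul]
        field_simp
      have e2 : (((1 - k * τ)⁻¹ • (w₀ + k • w), (1 - k * τ)⁻¹ • (β₀ + k • β)),
          (1 - k * τ)⁻¹ * (t₀ + k * (t - σ))) ∈ fitzEpi T := by
        rw [mem_fitzEpi] at hβ₀ ⊢
        intro c c' hc
        have f1 := hβ₀ c c' hc
        have f2 := mul_le_mul_of_nonneg_left (hσ' _ ⟨c, c', hc, rfl⟩) hk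
        refine le_trans (le_of_eq ?_) (mul_le_mul_of_nonneg_left
          (by linarith : β₀ c + k * β c + (c' w₀ + k * c' w) - (1 - k * τ) * c' c ≤
            t₀ + k * (t - σ)) (inv_pos.2 hμ).le)
        simp only [smul_apply, add_apply, map_smul, map_add, smul_eq_mul]
        field_simp
      have e3 := mul_le_mul_of_nonneg_left (hx _ _ _ (hHmem _ _ _ _ _ e1 e2)) hμ.le
      simp only [smul_apply, add_apply, map_smul, map_add, smul_eq_mul] at e3
      have e4 : ∀ r, (1 - k * τ) * ((1 - k * τ)⁻¹ * r) = r := fun r =>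
        mul_inv_cancel_left₀ hμ.ne' r
      simp only [mul_sub (1 - k * τ), mul_add (1 - k * τ), e4] at e3
      linarith
    have hpos : 0 < α x + β x + x' w - t + τ * (x' x - R) := by linarith
    set D := α x + β x + x' w - t + τ * (x' x - R)
    set c₀ := x' x - R - (x' w₀ + α₀ x + β₀ x - s₀ - t₀)
    have h3 := hk ((|c₀| + 1) / D) (by positivity)
    rw [div_mul_cancel₀ _ hpos.ne'] at h3
    linarith [le_abs_self c₀]
  obtain ⟨u, s, hu, hv⟩ := hmem
  have hu' := conjEpi_anti hS.1.couplingGraph_subset hu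
  have hv' := conjEpi_anti hT.1.couplingGraph_subset hv
  have e1 : u x ≤ s := hS.apply_le_of_mem_fitzEpi hu'
  have e2 : x' x - u x ≤ x' x - R - s := hT.apply_le_of_mem_fitzEpi hv'
  have hR0 : 0 ≤ R := by
    have := neg_half_norm_sq_le_apply (x' - z') (x - z)
    linarith
  obtain rfl : s = u x := by linarith
  refine ⟨x, u, hS.mem_of_mem_fitzEpi hu', x' - u, hT.mem_of_mem_fitzEpi ?_, ?_⟩
  · have hR1 : R = 0 := by linarith
    have : (x' - u) x = x' x - R - u x := by rw [sub_apply, hR1, sub_zero]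
    rw [this]
    exact hv'
  · rw [add_sub_cancel, ← hR]
    linarith

theorem isMaximalMonotoneOp_add [CompleteSpace X] (hX : IsReflexiveSpace X)
    (hS : IsMaximalMonotoneOp S) (hT : IsMaximalMonotoneOp T)
    {Y : Submodule ℝ X} (hY : IsClosed (Y : Set X))
    (hsub : ∀ x ∈ opDom S, ∀ y ∈ opDom T, x - y ∈ Y)
    (hcone : ∀ y ∈ Y, ∃ t : ℝ, 0 ≤ t ∧ ∃ p ∈ epiDom (fitzEpi S), ∃ q ∈ epiDom (fitzEpi T),
      y = t • (p - q))
    (hcommon : (epiDom (fitzEpi S) ∩ epiDom (fitzEpi T)).Nonempty) :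
    IsMaximalMonotoneOp (S + T) := by
  refine isMaximalMonotoneOp_of_related ?_ fun z z' h => ?_
  · rintro x y _ ⟨u, hu, v, hv, rfl⟩ _ ⟨u', hu', v', hv', rfl⟩
    have h1 := hS.1 x y u hu u' hu'
    have h2 := hT.1 x y v hv v' hv'
    simp only [add_apply, sub_apply] at *
    linarith
  · obtain ⟨x, u, hu, v, hv, hle⟩ := exists_mem_add_of_qualification hX hS hT hY hsub hcone
      hcommon z z'
    have h1 := h x (u + v) ⟨u, hu, v, hv, rfl⟩
    have h2 : (z' - (u + v)) (z - x) = (u + v - z') (x - z) := by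
      simp only [add_apply, sub_apply, map_sub]
      ring
    rw [h2] at h1
    have h3 : ‖x - z‖ = 0 := by
      have : ‖x - z‖ ^ 2 ≤ 0 := by linarith [sq_nonneg ‖u + v - z'‖]
      exact pow_eq_zero_iff two_ne_zero |>.1 (le_antisymm this (sq_nonneg _))
    have h4 : ‖u + v - z'‖ = 0 := by
      have : ‖u + v - z'‖ ^ 2 ≤ 0 := by linarith [sq_nonneg ‖x - z‖]
      exact pow_eq_zero_iff two_ne_zero |>.1 (le_antisymm this (sq_nonneg _))
    rw [norm_eq_zero, sub_eq_zero] at h3 h4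
    subst h3 h4
    exact ⟨u, hu, v, hv, rfl⟩

end SumTheorem

section Domains

variable {X : Type*} [NormedAddCommGroup X] [NormedSpace ℝ X] {S T : X → Set (StrongDual ℝ X)}

theorem zero_mem_sqri_sub_iff {A B : Set X} : (0 : X) ∈ sqri (A - B) ↔
    (A ∩ B).Nonempty ∧ ∃ Y : Submodule ℝ X, IsClosed (Y : Set X) ∧
      (∀ a ∈ A, ∀ b ∈ B, a - b ∈ Y) ∧
      ∀ y ∈ Y, ∃ t : ℝ, 0 ≤ t ∧ ∃ a ∈ A, ∃ b ∈ B, y = t • (a - b) := by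
  have h0 : (0 : X) ∈ A - B ↔ (A ∩ B).Nonempty := by
    constructor
    · rintro ⟨a, ha, b, hb, hab⟩
      obtain rfl := sub_eq_zero.1 hab
      exact ⟨a, ha, hb⟩
    · rintro ⟨a, ha, hb⟩
      exact ⟨a, ha, a, hb, sub_self a⟩
  refine and_congr h0 (exists_congr fun Y => and_congr_right fun _ => ?_)
  simp only [sub_zero, Set.image_id']
  constructor
  · intro h
    refine ⟨fun a ha b hb => ?_, fun y hy => ?_⟩
    · rw [← SetLike.mem_coe, ← h]
      exact ⟨1, zero_le_one, a - b, ⟨a, ha, b, hb, rfl⟩, (one_smul ℝ _).symm⟩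
    · rw [← SetLike.mem_coe, ← h] at hy
      obtain ⟨t, ht, _, ⟨a, ha, b, hb, rfl⟩, rfl⟩ := hy
      exact ⟨t, ht, a, ha, b, hb, rfl⟩
  · rintro ⟨h1, h2⟩
    refine Set.Subset.antisymm ?_ fun y hy => ?_
    · rintro _ ⟨t, ht, _, ⟨a, ha, b, hb, rfl⟩, rfl⟩
      exact Y.smul_mem t (h1 a ha b hb)
    · obtain ⟨t, ht, a, ha, b, hb, rfl⟩ := h2 y hy
      exact ⟨t, ht, a - b, ⟨a, ha, b, hb, rfl⟩, rfl⟩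

theorem sub_mem_of_mem_epiDom_fitzEpi (hS : IsMaximalMonotoneOp S) (hT : IsMaximalMonotoneOp T)
    {Y : Submodule ℝ X} (hY : IsClosed (Y : Set X))
    (hsub : ∀ x ∈ opDom S, ∀ y ∈ opDom T, x - y ∈ Y) {p q : X}
    (hp : p ∈ epiDom (fitzEpi S)) (hq : q ∈ epiDom (fitzEpi T)) : p - q ∈ Y := by
  obtain ⟨a, ha⟩ := hS.nonempty_opDom
  obtain ⟨b, hb⟩ := hT.nonempty_opDom
  have h1 := hS.sub_mem_of_mem_epiDom_fitzEpi hY (s := a) (fun w hw => by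
    simpa using Y.sub_mem (hsub w hw b hb) (hsub a ha b hb)) hp
  have h2 := hT.sub_mem_of_mem_epiDom_fitzEpi hY (s := b) (fun w hw => by
    simpa using Y.sub_mem (hsub a ha b hb) (hsub a ha w hw)) hq
  have : p - q = (p - a) - (q - b) + (a - b) := by abel
  rw [this]
  exact Y.add_mem (Y.sub_mem h1 h2) (hsub a ha b hb)

theorem convex_epiDom {E : Set ((X × StrongDual ℝ X) × ℝ)} (hE : Convex ℝ E) :
    Convex ℝ (epiDom E) := by
  rintro x ⟨u, r, h⟩ y ⟨v, s, h'⟩ a b ha hb hab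
  exact ⟨_, _, hE h h' ha hb hab⟩

theorem IsMaximalMonotoneOp.translate (hT : IsMaximalMonotoneOp T) (w : X) :
    IsMaximalMonotoneOp fun x => T (x - w) := by
  refine isMaximalMonotoneOp_of_related ?_ fun x u h => hT.mem_of_related fun a a' ha => ?_
  · intro x y u hu v hv
    simpa using hT.1 _ _ u hu v hv
  · have := h (a + w) a' (by simpa using ha)
    rwa [sub_sub, add_comm w]

theorem add_mem_epiDom_fitzEpi_translate {x : X} (hx : x ∈ epiDom (fitzEpi T)) (w : X) :
    x + w ∈ epiDom (fitzEpi fun x => T (x - w)) := by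
  obtain ⟨u, r, h⟩ := hx
  refine ⟨u, r + u w, ?_⟩
  rw [mem_fitzEpi] at h ⊢
  intro a a' ha
  have := h _ _ ha
  simp only [map_sub, map_add] at *
  linarith

theorem half_sub_mem_opDom_sub [CompleteSpace X] (hX : IsReflexiveSpace X)
    (hS : IsMaximalMonotoneOp S) (hT : IsMaximalMonotoneOp T)
    {Y : Submodule ℝ X} (hY : IsClosed (Y : Set X))
    (hsub : ∀ x ∈ opDom S, ∀ y ∈ opDom T, x - y ∈ Y)
    (hcone : ∀ y ∈ Y, ∃ t : ℝ, 0 ≤ t ∧ ∃ p ∈ epiDom (fitzEpi S), ∃ q ∈ epiDom (fitzEpi T),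
      y = t • (p - q))
    (hcommon : (epiDom (fitzEpi S) ∩ epiDom (fitzEpi T)).Nonempty) {p q : X}
    (hp : p ∈ epiDom (fitzEpi S)) (hq : q ∈ epiDom (fitzEpi T)) :
    (1 / 2 : ℝ) • (p - q) ∈ opDom S - opDom T := by
  set w := (1 / 2 : ℝ) • (p - q) with hw
  have hwY : w ∈ Y := Y.smul_mem _ (sub_mem_of_mem_epiDom_fitzEpi hS hT hY hsub hp hq)
  have mid : ∀ {R : X → Set (StrongDual ℝ X)} {x y : X}, x ∈ epiDom (fitzEpi R) →
      y ∈ epiDom (fitzEpi R) → (1 / 2 : ℝ) • x + (1 / 2 : ℝ) • y ∈ epiDom (fitzEpi R) :=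
    fun hx hy => convex_epiDom (convex_conjEpi _) hx hy (by norm_num) (by norm_num) (by norm_num)
  obtain ⟨c, hc, hc'⟩ := hcommon
  obtain ⟨x, u, hu, v, hv, -⟩ := exists_mem_add_of_qualification hX hS (hT.translate w) hY
    (fun x hx y hy => by
      have : x - y = x - (y - w) - w := by abel
      rw [this]
      exact Y.sub_mem (hsub x hx (y - w) hy) hwY)
    (fun y hy => by
      obtain ⟨t, ht, p₁, hp₁, q₁, hq₁, rfl⟩ := hcone y hy
      refine ⟨2 * t, by positivity, _, mid hp₁ hp, _,
        add_mem_epiDom_fitzEpi_translate (mid hq₁ hq) w, ?_⟩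
      rw [hw]
      module)
    ⟨_, mid hc hp, by
      convert add_mem_epiDom_fitzEpi_translate (mid hc' hq) w using 1
      rw [hw]
      module⟩ 0 0
  exact ⟨x, ⟨u, hu⟩, x - w, ⟨v, hv⟩, sub_sub_cancel x w⟩

theorem zero_mem_sqri_opDom_sub_of_epiDom [CompleteSpace X] (hX : IsReflexiveSpace X)
    (hS : IsMaximalMonotoneOp S) (hT : IsMaximalMonotoneOp T)
    (h : (0 : X) ∈ sqri (epiDom (fitzEpi S) - epiDom (fitzEpi T))) :
    (0 : X) ∈ sqri (opDom S - opDom T) := by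
  obtain ⟨⟨c, hc, hc'⟩, Y, hY, hsub, hcone⟩ := zero_mem_sqri_sub_iff.1 h
  have hS' := (opDom_subset_epiDom_couplingGraph S).trans
    (epiDom_mono hS.1.couplingGraph_subset)
  have hT' := (opDom_subset_epiDom_couplingGraph T).trans
    (epiDom_mono hT.1.couplingGraph_subset)
  have hsub' : ∀ x ∈ opDom S, ∀ y ∈ opDom T, x - y ∈ Y :=
    fun x hx y hy => hsub x (hS' hx) y (hT' hy)
  have hhalf := fun p (hp : p ∈ epiDom (fitzEpi S)) q (hq : q ∈ epiDom (fitzEpi T)) =>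
    half_sub_mem_opDom_sub hX hS hT hY hsub' hcone ⟨c, hc, hc'⟩ hp hq
  refine zero_mem_sqri_sub_iff.2 ⟨?_, Y, hY, hsub', fun y hy => ?_⟩
  · obtain ⟨a, ha, b, hb, hab⟩ := hhalf c hc c hc'
    simp only [sub_self, smul_zero] at hab
    obtain rfl := sub_eq_zero.1 hab
    exact ⟨a, ha, hb⟩
  · obtain ⟨t, ht, p, hp, q, hq, rfl⟩ := hcone y hy
    obtain ⟨a, ha, b, hb, hab⟩ := hhalf p hp q hq
    simp only at hab
    refine ⟨2 * t, by positivity, a, ha, b, hb, ?_⟩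
    rw [hab]
    module

theorem zero_mem_sqri_sub_of_between (hS : IsMaximalMonotoneOp S) (hT : IsMaximalMonotoneOp T)
    {A A' B B' : Set X} (hA : opDom S ⊆ A) (hAA : A ⊆ A') (hA' : A' ⊆ epiDom (fitzEpi S))
    (hB : opDom T ⊆ B) (hBB : B ⊆ B') (hB' : B' ⊆ epiDom (fitzEpi T))
    (h : (0 : X) ∈ sqri (A - B)) : (0 : X) ∈ sqri (A' - B') := by
  obtain ⟨⟨c, hc, hc'⟩, Y, hY, hsub, hcone⟩ := zero_mem_sqri_sub_iff.1 h
  refine zero_mem_sqri_sub_iff.2 ⟨⟨c, hAA hc, hBB hc'⟩, Y, hY, fun a ha b hb => ?_, fun y hy => ?_⟩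
  · exact sub_mem_of_mem_epiDom_fitzEpi hS hT hY
      (fun x hx y hy => hsub x (hA hx) y (hB hy)) (hA' ha) (hB' hb)
  · obtain ⟨t, ht, p, hp, q, hq, rfl⟩ := hcone y hy
    exact ⟨t, ht, p, hAA hp, q, hBB hq, rfl⟩

end Domains

section Representatives

variable {X : Type*} [NormedAddCommGroup X] [NormedSpace ℝ X] {S T : X → Set (StrongDual ℝ X)}
  {f g : X × StrongDual ℝ X → EReal}

/-- The epigraph of an extended real valued function. -/
def epigraphOf {E : Type*} (f : E → EReal) : Set (E × ℝ) := {p | f p.1 ≤ (p.2 : EReal)}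

theorem isClosed_epigraphOf {E : Type*} [TopologicalSpace E] {f : E → EReal}
    (hf : LowerSemicontinuous f) : IsClosed (epigraphOf f) :=
  hf.isClosed_epigraph.preimage
    (f := fun p : E × ℝ => (p.1, (p.2 : EReal)))
    (by have := continuous_coe_real_ereal; fun_prop)

theorem lowerSemicontinuous_of_isClosed_epigraphOf {E : Type*} [TopologicalSpace E]
    {f : E → EReal} (h : IsClosed (epigraphOf f)) : LowerSemicontinuous f := by
  have hreal : ∀ r : ℝ, IsClosed {x | f x ≤ r} := fun r =>
    h.preimage (f := fun x => (x, r)) (by fun_prop)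
  rw [lowerSemicontinuous_iff_isClosed_preimage]
  intro y
  induction y using EReal.rec with
  | bot =>
    have : f ⁻¹' Set.Iic ⊥ = ⋂ r : ℝ, {x | f x ≤ r} := by
      ext x
      simp only [Set.mem_preimage, Set.mem_Iic, le_bot_iff, Set.mem_iInter, Set.mem_ofPred_eq]
      rw [EReal.eq_bot_iff_forall_lt]
      refine ⟨fun h r => (h r).le, fun h r => (h (r - 1)).trans_lt ?_⟩
      exact_mod_cast sub_one_lt r
    rw [this]
    exact isClosed_iInter hreal
  | coe r => exact hreal r
  | top => simp

theorem epiDom_epigraphOf (f : X × StrongDual ℝ X → EReal) :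
    epiDom (epigraphOf f) = Prod.fst '' effDom f := by
  ext x
  constructor
  · rintro ⟨u, r, h⟩
    exact ⟨(x, u), lt_of_le_of_lt h (EReal.coe_lt_top r), rfl⟩
  · rintro ⟨⟨x, u⟩, h, rfl⟩
    obtain ⟨r, h1, -⟩ := EReal.lt_iff_exists_real_btwn.1 h
    exact ⟨u, r, h1.le⟩

theorem IsRepresentative.couplingGraph_subset (hf : IsRepresentative f T) :
    couplingGraph T ⊆ epigraphOf f := by
  rintro ⟨⟨x, u⟩, r⟩ ⟨h1, h2⟩
  simp only at h1 h2
  subst h2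
  exact (hf.eq_coupling x u h1).le

theorem IsRepresentative.epigraphOf_subset_fitzEpi (hf : IsRepresentative f T) :
    epigraphOf f ⊆ fitzEpi T := by
  rintro ⟨⟨x, u⟩, r⟩ h
  rw [mem_fitzEpi]
  intro a a' ha
  by_contra! hlt
  set D := u a + a' x - a' a - r with hD
  have hD0 : 0 < D := by linarith
  have hsmall : ∀ t : ℝ, 0 < t → t ≤ 1 → D ≤ t * |(u - a') (x - a)| := by
    intro t ht ht1
    have e1 := hf.convex (hf.couplingGraph_subset (a := ((a, a'), a' a)) ⟨ha, rfl⟩) h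
      (sub_nonneg.2 ht1) ht.le (sub_add_cancel 1 t)
    have e2 := EReal.coe_le_coe_iff.1 ((hf.coupling_le _ _).trans e1)
    have e3 : t * D ≤ t * (t * -(u - a') (x - a)) := by
      simp only [Prod.smul_mk, Prod.mk_add_mk, add_apply, sub_apply, smul_apply, map_add, map_sub,
        map_smul, smul_eq_mul] at e2 ⊢
      linarith
    refine (le_of_mul_le_mul_left e3 ht).trans ?_
    exact mul_le_mul_of_nonneg_left (neg_le_abs _) ht.le
  set c := |(u - a') (x - a)| with hc
  have hc0 : 0 ≤ c := abs_nonneg _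
  have h1 := hsmall (min 1 (D / (2 * (c + 1)))) (by positivity) (min_le_left _ _)
  have h2 : min 1 (D / (2 * (c + 1))) * c ≤ D / (2 * (c + 1)) * (c + 1) :=
    mul_le_mul (min_le_right _ _) (by linarith) hc0 (by positivity)
  have h3 : D / (2 * (c + 1)) * (c + 1) = D / 2 := by field_simp
  linarith

theorem IsRepresentative.opDom_subset_epiDom_conjEpi (hf : IsRepresentative f T) :
    opDom T ⊆ epiDom (conjEpi (epigraphOf f)) :=
  (opDom_subset_epiDom_couplingGraph T).trans <| epiDom_mono <|
    (subset_conjEpi_conjEpi _).trans (conjEpi_anti hf.epigraphOf_subset_fitzEpi)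

theorem IsRepresentative.shiftInvariant (hf : IsRepresentative f T) (hT : IsMaximalMonotoneOp T)
    {Y : Submodule ℝ X} {s : X} (hs : ∀ x ∈ opDom T, x - s ∈ Y) :
    ShiftInvariant (epigraphOf f) Y s := by
  intro η hη x u r h
  obtain ⟨a, a', ha⟩ := hT.nonempty_opDom
  have hηa : η a = η s := by
    have := hη _ (hs a ⟨a', ha⟩)
    rw [map_sub] at this
    linarith
  have hmem : ∀ ε ∈ Set.Ioo (0 : ℝ) 1,
      (((1 - ε) • x + ε • a, (1 - ε) • u + ε • a' + η), (1 - ε) * r + ε * a' a + η a) ∈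
        epigraphOf f := by
    intro ε hε
    have h1 : a' + ε⁻¹ • η ∈ T a :=
      hT.add_mem_of_annihilator hs (fun y hy => by simp [hη y hy]) ha
    have h2 := hf.convex h (hf.couplingGraph_subset
      (a := ((a, a' + ε⁻¹ • η), (a' + ε⁻¹ • η) a)) ⟨h1, rfl⟩)
      (sub_nonneg.2 hε.2.le) hε.1.le (sub_add_cancel 1 ε)
    have hε0 := hε.1.ne'
    have e : (((1 - ε) • x + ε • a, (1 - ε) • u + ε • a' + η),
        (1 - ε) * r + ε * a' a + η a) = (1 - ε) • ((x, u), r) +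
          ε • ((a, a' + ε⁻¹ • η), (a' + ε⁻¹ • η) a) := by
      simp only [Prod.smul_mk, Prod.mk_add_mk, smul_add, smul_inv_smul₀ hε0, add_apply, smul_apply,
        smul_eq_mul, mul_add, mul_inv_cancel_left₀ hε0, add_assoc]
    rw [e]
    exact h2
  have hlim : Tendsto (fun ε : ℝ => (((1 - ε) • x + ε • a, (1 - ε) • u + ε • a' + η),
      (1 - ε) * r + ε * a' a + η a)) (𝓝[>] 0) (𝓝 ((x, u + η), r + η s)) := by
    refine tendsto_nhdsWithin_of_tendsto_nhds ?_
    convert (by fun_prop : Continuous fun ε : ℝ => (((1 - ε) • x + ε • a,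
      (1 - ε) • u + ε • a' + η), (1 - ε) * r + ε * a' a + η a)).tendsto 0 using 2
    simp [hηa]
  exact (isClosed_epigraphOf hf.lsc).mem_of_tendsto hlim
    (eventually_of_mem (Ioo_mem_nhdsGT one_pos) hmem)

theorem IsRepresentative.isClosed_epiInfConv [CompleteSpace X] (hX : IsReflexiveSpace X)
    (hS : IsMaximalMonotoneOp S) (hT : IsMaximalMonotoneOp T)
    (hf : IsRepresentative f S) (hg : IsRepresentative g T)
    (h : (0 : X) ∈ sqri (opDom S - opDom T)) :
    IsClosed (epiInfConv (epigraphOf f) (epigraphOf g)) := by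
  obtain ⟨⟨c, hc, hc'⟩, Y, hY, hsub, hcone⟩ := zero_mem_sqri_sub_iff.1 h
  refine _root_.isClosed_epiInfConv hX hf.convex hg.convex (isClosed_epigraphOf hf.lsc)
    (isClosed_epigraphOf hg.lsc) hY (a := c) (b := c) (by simp)
    (hf.shiftInvariant hS fun x hx => hsub x hx c hc')
    (hg.shiftInvariant hT fun x hx => by simpa using Y.neg_mem (hsub c hc x hx)) fun y hy => ?_
  obtain ⟨t, ht, p, hp, q, hq, rfl⟩ := hcone y hy
  exact ⟨t, ht, p, hf.opDom_subset_epiDom_conjEpi hp, q, hg.opDom_subset_epiDom_conjEpi hq, rfl⟩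

theorem epigraphOf_infConvSnd (hf : ∀ p, f p ≠ ⊥) (hg : ∀ p, g p ≠ ⊥)
    (hcl : IsClosed (epiInfConv (epigraphOf f) (epigraphOf g))) :
    epigraphOf (infConvSnd f g) =
      {p | ((p.1.1, p.1.1, p.1.2), p.2) ∈ epiInfConv (epigraphOf f) (epigraphOf g)} := by
  ext ⟨⟨x, x'⟩, r⟩
  constructor
  · intro h
    have hmem : ∀ ε ∈ Set.Ioi (0 : ℝ),
        ((x, x, x'), r + ε) ∈ epiInfConv (epigraphOf f) (epigraphOf g) := by
      intro ε hε
      have h1 : infConvSnd f g (x, x') < ((r + ε : ℝ) : EReal) := lt_of_le_of_lt h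
        (EReal.coe_lt_coe_iff.2 (lt_add_of_pos_right r hε))
      obtain ⟨c, hc⟩ := iInf_lt_iff.1 h1
      have hft : f (x, c) ≠ ⊤ := fun h0 => by
        simp only [h0, EReal.top_add_of_ne_bot (hg _), not_top_lt] at hc
      have hgt : g (x, x' - c) ≠ ⊤ := fun h0 => by
        simp only [h0, EReal.add_top_of_ne_bot (hf _), not_top_lt] at hc
      refine ⟨c, (f (x, c)).toReal, (EReal.coe_toReal hft (hf _)).ge, ?_⟩
      simp only at hc
      rw [← EReal.coe_toReal hft (hf _), ← EReal.coe_toReal hgt (hg _), ← EReal.coe_add,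
        EReal.coe_lt_coe_iff] at hc
      change g (x, x' - c) ≤ _
      rw [← EReal.coe_toReal hgt (hg _), EReal.coe_le_coe_iff]
      simp only
      linarith
    have hlim : Tendsto (fun ε : ℝ => ((x, x, x'), r + ε)) (𝓝[>] 0) (𝓝 ((x, x, x'), r)) := by
      refine tendsto_nhdsWithin_of_tendsto_nhds ?_
      convert (by fun_prop : Continuous fun ε : ℝ => ((x, x, x'), r + ε)).tendsto 0 using 2
      simp
    exact hcl.mem_of_tendsto hlim (eventually_of_mem self_mem_nhdsWithin hmem)
  · rintro ⟨u, s, h1, h2⟩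
    have h1' : f (x, u) ≤ (s : EReal) := h1
    have h2' : g (x, x' - u) ≤ ((r - s : ℝ) : EReal) := h2
    refine (iInf_le (fun c => f (x, c) + g (x, x' - c)) u).trans
      ((add_le_add h1' h2').trans ?_)
    rw [← EReal.coe_add, add_sub_cancel]

theorem IsRepresentative.infConvSnd [CompleteSpace X] (hX : IsReflexiveSpace X)
    (hS : IsMaximalMonotoneOp S) (hT : IsMaximalMonotoneOp T)
    (hf : IsRepresentative f S) (hg : IsRepresentative g T)
    (h : (0 : X) ∈ sqri (opDom S - opDom T)) (hST : IsMonotoneOp (S + T)) :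
    IsRepresentative (infConvSnd f g) (S + T) := by
  have hcl := hf.isClosed_epiInfConv hX hS hT hg h
  have hbot : ∀ {k : X × StrongDual ℝ X → EReal} {R : X → Set (StrongDual ℝ X)},
      IsRepresentative k R → ∀ p, k p ≠ ⊥ := fun hk p =>
    ((EReal.bot_lt_coe _).trans_le (hk.coupling_le p.1 p.2)).ne'
  have hepi := epigraphOf_infConvSnd (hbot hf) (hbot hg) hcl
  have hle : ∀ (x : X) (x' : StrongDual ℝ X), ((x' x : ℝ) : EReal) ≤ _root_.infConvSnd f g (x, x') :=
    fun x x' => le_iInf fun c => by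
      refine le_trans (le_of_eq ?_) (add_le_add (hf.coupling_le x c) (hg.coupling_le x (x' - c)))
      rw [← EReal.coe_add]
      simp
  refine ⟨hST, ?_, ?_, hle, ?_⟩
  · change Convex ℝ (epigraphOf (_root_.infConvSnd f g))
    rw [hepi]
    exact fun p hp q hq c d hc hd hcd => convex_epiInfConv hf.convex hg.convex
      (x := ((p.1.1, p.1.1, p.1.2), p.2)) hp (y := ((q.1.1, q.1.1, q.1.2), q.2)) hq hc hd hcd
  · refine lowerSemicontinuous_of_isClosed_epigraphOf ?_
    rw [hepi]
    exact hcl.preimage (f := fun p : (X × StrongDual ℝ X) × ℝ => ((p.1.1, p.1.1, p.1.2), p.2))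
      (by fun_prop)
  · rintro x _ ⟨u, hu, v, hv, rfl⟩
    refine le_antisymm ((iInf_le _ u).trans ?_) (hle _ _)
    simp only [add_sub_cancel_left, hf.eq_coupling x u hu, hg.eq_coupling x v hv, add_apply,
      EReal.coe_add, le_refl]

end Representatives

section Bifunctions

variable {X : Type*} [NormedAddCommGroup X] [NormedSpace ℝ X] {C : Set X} {F G : C → C → ℝ}

theorem IsMonotoneBif.isMonotoneOp (hF : IsMonotoneBif F) (hF0 : ∀ x, F x x = 0) :
    IsMonotoneOp (bifOp F) := by
  rintro x y u ⟨hx, hu⟩ v ⟨hy, hv⟩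
  have h1 := hu ⟨y, hy⟩
  have h2 := hv ⟨x, hx⟩
  have h3 := hF ⟨x, hx⟩ ⟨y, hy⟩
  rw [hF0] at h1 h2
  simp only [map_sub, sub_apply] at *
  linarith

theorem bifOp_add_subset (F G : C → C → ℝ) (x : X) :
    (bifOp F + bifOp G) x ⊆ bifOp (fun x y => F x y + G x y) x := by
  rintro _ ⟨u, ⟨hx, hu⟩, v, ⟨_, hv⟩, rfl⟩
  refine ⟨hx, fun y => ?_⟩
  have h1 := hu y
  have h2 := hv y
  simp only [add_apply] at *
  linarith

end Bifunctions

theorem mainTheorem5 {X : Type*} [NormedAddCommGroup X] [NormedSpace ℝ X] [CompleteSpace X]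
    (hX : IsReflexiveSpace X) (C : Set X) (F G : C → C → ℝ)
    (hF0 : ∀ x : C, F x x = 0) (hG0 : ∀ x : C, G x x = 0)
    (hF : IsMaximalMonotoneBif F) (hG : IsMaximalMonotoneBif G)
    (fF fG : X × StrongDual ℝ X → EReal)
    (hfF : IsRepresentative fF (bifOp F)) (hfG : IsRepresentative fG (bifOp G)) :
    ((0 : X) ∈ sqri (opDom (bifOp F) - opDom (bifOp G)) ↔
      (0 : X) ∈ sqri (Prod.fst '' effDom fF - Prod.fst '' effDom fG)) ∧
    ((0 : X) ∈ sqri (opDom (bifOp F) - opDom (bifOp G)) →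
      IsMaximalMonotoneBif (fun x y => F x y + G x y) ∧
      (∀ x : X, bifOp F x + bifOp G x = bifOp (fun x y => F x y + G x y) x) ∧
      IsRepresentative (infConvSnd fF fG) (bifOp (fun x y => F x y + G x y))) := by
  have dom_le : ∀ {f : X × StrongDual ℝ X → EReal} {T : X → Set (StrongDual ℝ X)},
      IsRepresentative f T → opDom T ⊆ Prod.fst '' effDom f := by
    intro f T hf
    rw [← epiDom_epigraphOf]
    exact (opDom_subset_epiDom_couplingGraph T).trans (epiDom_mono hf.couplingGraph_subset)
  have le_dom : ∀ {f : X × StrongDual ℝ X → EReal} {T : X → Set (StrongDual ℝ X)},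
      IsRepresentative f T → Prod.fst '' effDom f ⊆ epiDom (fitzEpi T) := by
    intro f T hf
    rw [← epiDom_epigraphOf]
    exact epiDom_mono hf.epigraphOf_subset_fitzEpi
  refine ⟨⟨fun h => ?_, fun h => ?_⟩, fun h => ?_⟩
  · exact zero_mem_sqri_sub_of_between hF.2 hG.2 subset_rfl (dom_le hfF) (le_dom hfF) subset_rfl
      (dom_le hfG) (le_dom hfG) h
  · exact zero_mem_sqri_opDom_sub_of_epiDom hX hF.2 hG.2 (zero_mem_sqri_sub_of_between hF.2 hG.2
      (dom_le hfF) (le_dom hfF) subset_rfl (dom_le hfG) (le_dom hfG) subset_rfl h)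
  · obtain ⟨hcommon, Y, hY, hsub, hcone⟩ := zero_mem_sqri_sub_iff.1
      (zero_mem_sqri_sub_of_between hF.2 hG.2 subset_rfl ((dom_le hfF).trans (le_dom hfF))
        subset_rfl subset_rfl ((dom_le hfG).trans (le_dom hfG)) subset_rfl h)
    have hmax : IsMaximalMonotoneOp (bifOp F + bifOp G) :=
      isMaximalMonotoneOp_add hX hF.2 hG.2 hY
        (fun x hx y hy => hsub x (le_dom hfF (dom_le hfF hx)) y (le_dom hfG (dom_le hfG hy)))
        hcone hcommon
    have hmono : IsMonotoneBif fun x y => F x y + G x y := fun x y => by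
      linarith [hF.1 x y, hG.1 x y]
    have heq : bifOp (fun x y => F x y + G x y) = bifOp F + bifOp G :=
      hmax.2 _ (hmono.isMonotoneOp fun x => by simp [hF0, hG0]) (bifOp_add_subset F G)
    refine ⟨⟨hmono, heq ▸ hmax⟩, fun x => by rw [heq]; rfl, ?_⟩
    rw [heq]
    exact hfF.infConvSnd hX hF.2 hG.2 hfG h hmax.1
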